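/- Let $\mathfrak H=\{\tau\in\mathbb C:\operatorname{Im}\tau>0\}$, and for $\tau\in\mathfrak H$ put $q=e^{2\pi i\tau}$, $t=e^{\pi i\tau}$ (so $t^{x}=e^{\pi i x\tau}$ for real $x$), $$E_4(\tau)=1+240\sum_{n\ge1}\sigma_3(n)q^n,$$ $$\theta_2(\tau)=2\sum_{n\ge0}t^{(n+1/2)^2},\qquad \theta_3(\tau)=1+2\sum_{n\ge1}t^{n^2},\qquad \theta_4(\tau)=1+2\sum_{n\ge1}(-1)^nt^{n^2},$$ where $\sigma_3(n)$ is the sum of the cubes of the positive divisors of $n$, and let $\lambda=\theta_2^4/\theta_3^4$. Derivatives are taken with respect to $\tau$. The functions $\theta_2,\theta_3,\theta_4$ have no zeros in $\mathfrak H$, and the functions $$y_1=\frac{\theta_2^2}{\theta_3^2\theta_4^2},\qquad y_2=\frac{\theta_3^2}{\theta_2^2\theta_4^2}$$ are holomorphic solutions on $\mathfrak H$ of the differential equation $$y''+\frac{\pi^2}{4}E_4\,y=0,$$ are linearly independent over $\mathbb C$, and every holomorphic solution on $\mathfrak H$ is a $\mathbb C$-linear combination of them; that is, $(y_1,y_2)$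 is a basis of the space of solutions. Moreover, $\lambda$ is holomorphic on $\mathfrak H$, $\lambda'$ vanishes nowhere on $\mathfrak H$, and, with the principal values of $(i\pi)^{\pm1/2}$, the holomorphic function $$\sqrt{\lambda'}:=(i\pi)^{1/2}\,\frac{\theta_4^2\theta_2^2}{\theta_3^2}$$ is a square root of $\lambda'$ on $\mathfrak H$, for which $$\frac{\lambda}{\sqrt{\lambda'}}=(i\pi)^{-1/2}\,y_1,\qquad \frac{1}{\sqrt{\lambda'}}=(i\pi)^{-1/2}\,y_2 .$$ -/

import Mathlib

open UpperHalfPlane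

noncomputable section

namespace ThetaODE

/-- `θ₂(τ) = 2 ∑_{n ≥ 0} t ^ ((n + 1/2)²)` with `t = exp (π i τ)`. -/
def theta2 (τ : ℍ) : ℂ :=
  2 * ∑' n : ℕ, Complex.exp (Real.pi * Complex.I * ((n : ℂ) + 1 / 2) ^ 2 * τ)

/-- `θ₃(τ) = 1 + 2 ∑_{n ≥ 1} t ^ (n²)` with `t = exp (π i τ)`. -/
def theta3 (τ : ℍ) : ℂ :=
  1 + 2 * ∑' n : ℕ, Complex.exp (Real.pi * Complex.I * ((n : ℂ) + 1) ^ 2 * τ)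

/-- `θ₄(τ) = 1 + 2 ∑_{n ≥ 1} (-1) ^ n t ^ (n²)` with `t = exp (π i τ)`. -/
def theta4 (τ : ℍ) : ℂ :=
  1 + 2 * ∑' n : ℕ, (-1 : ℂ) ^ (n + 1) *
    Complex.exp (Real.pi * Complex.I * ((n : ℂ) + 1) ^ 2 * τ)

/-- The elliptic modular function `λ = θ₂⁴ / θ₃⁴`. -/
def lam (τ : ℍ) : ℂ := theta2 τ ^ 4 / theta3 τ ^ 4

/-- `y₁ = θ₂² / (θ₃² θ₄²)`. -/
def y1 (τ : ℍ) : ℂ := theta2 τ ^ 2 / (theta3 τ ^ 2 * theta4 τ ^ 2)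

/-- `y₂ = θ₃² / (θ₂² θ₄²)`. -/
def y2 (τ : ℍ) : ℂ := theta3 τ ^ 2 / (theta2 τ ^ 2 * theta4 τ ^ 2)

/-- A function on the upper half-plane is holomorphic. -/
def Holo (f : ℍ → ℂ) : Prop := DifferentiableOn ℂ (f ∘ ofComplex) {z : ℂ | 0 < z.im}

/-- The complex derivative `df/dτ` of a function on the upper half-plane. -/
def D (f : ℍ → ℂ) (τ : ℍ) : ℂ := deriv (f ∘ ofComplex) (τ : ℂ)

/-- `y` is a holomorphic solution on the upper half-plane of `y'' + (π²/4) E₄ y = 0`. -/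
def IsSolution (y : ℍ → ℂ) : Prop :=
  Holo y ∧ ∀ τ : ℍ, D (D y) τ + (Real.pi : ℂ) ^ 2 / 4 * ModularForm.E₄ τ * y τ = 0

/-- The branch `(iπ)^(1/2) θ₄² θ₂² / θ₃²` of the square root of `λ'`
(principal value of `(iπ)^(1/2)`). -/
def sqrtLamDeriv (τ : ℍ) : ℂ :=
  (Complex.I * Real.pi) ^ (1 / 2 : ℂ) * (theta4 τ ^ 2 * theta2 τ ^ 2 / theta3 τ ^ 2)

end ThetaODE

end

/-! Everything rests on level-one forms being scarce: cusp forms vanish below weight 12 and are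
multiples of the discriminant in weight 12, while a weight 4 form is fixed by its value at `i∞`. The
fourth powers of the theta constants are permuted by `S` and `T` up to sign and the factor `-z ^ 2`,
so suitable symmetric combinations have level one. This gives non-vanishing (`theta_mul_ne_zero`),
`jacobi_identity` and `two_mul_E₄`.

The same principle yields the Halphen system: each logarithmic derivative of a theta constant is
their mean `m` plus a linear form in fourth powers (`logDeriv_meanLogDeriv_identities`), and `m' = 2
m² + (π² / 72) E₄` (`deriv_meanLogDeriv`). Hence `y₁` and `y₂` satisfy `Y' = U Y` with explicit `U`.
In `U' + U²` all terms in `m` cancel, leaving `-(π² / 4) E₄`.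

The equation has no first-order term, so Wronskians are constant. That of `y₁, y₂` is `-π i`, which
gives independence and, by Cramer's rule, spanning. The claims on `√λ'` follow from
`hasDerivAt_lambda`. -/

section

open Filter Topology ModularForm ModularGroup Complex
open scoped Real MatrixGroups

noncomputable section

namespace ThetaODE

/-! ### Level-one modular forms of small weight -/

section LevelOne

/-- The cusp form of level one attached to a holomorphic function on the upper half-plane that
transforms correctly under `z ↦ z + 1` and `z ↦ -1 / z` and vanishes at `i∞`. -/
def cuspFormOfGenerators (F : ℂ → ℂ) (k : ℕ)
    (hd : DifferentiableOn ℂ F {z | 0 < z.im})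
    (hT : ∀ z : ℂ, 0 < z.im → F (z + 1) = F z)
    (hS : ∀ z : ℂ, 0 < z.im → F (-1 / z) = z ^ k * F z)
    (h0 : Tendsto F (comap Complex.im atTop) (𝓝 0)) : CuspForm 𝒮ℒ k :=
  have hslash : ∀ γ : SL(2, ℤ), (fun τ : ℍ ↦ F τ) ∣[(k : ℤ)] γ = fun τ : ℍ ↦ F τ := by
    refine SlashInvariantForm.slash_action_generators_SL2Z ?_ ?_
    · ext τ
      have hτ : (τ : ℂ) ≠ 0 := ne_zero τ
      have h : F (-(τ : ℂ))⁻¹ = τ ^ k * F τ := by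
        rw [← hS τ τ.im_pos, neg_div, one_div, inv_neg]
      rw [SlashInvariantForm.slash_S_apply]
      simp only [h, zpow_neg, zpow_natCast]
      field_simp
    · ext τ
      have h := hT τ τ.im_pos
      have hden : denom T τ = 1 := by
        rw [ModularGroup.denom_apply]
        simp [ModularGroup.T]
      rw [SL_slash_apply, hden, UpperHalfPlane.modular_T_smul]
      simp [add_comm (1 : ℂ), h]
  { toFun := fun τ ↦ F τ
    slash_action_eq' := by
      rintro _ ⟨γ, rfl⟩
      exact hslash γ
    holo' := by
      rw [UpperHalfPlane.mdifferentiable_iff]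
      refine hd.congr fun z hz ↦ ?_
      simp [ofComplex_apply_of_im_pos hz]
    zero_at_cusps' := fun hc ↦ by
      rw [Subgroup.IsArithmetic.isCusp_iff_isCusp_SL2Z] at hc
      rw [OnePoint.isZeroAt_iff_forall_SL2Z hc]
      intro γ _
      rw [hslash]
      exact h0.comp tendsto_coe_atImInfty }

/-- A cusp form of level one and weight less than `12` vanishes. -/
lemma eq_zero_of_generators {F : ℂ → ℂ} {k : ℕ} (hk : k < 12)
    (hd : DifferentiableOn ℂ F {z | 0 < z.im})
    (hT : ∀ z : ℂ, 0 < z.im → F (z + 1) = F z)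
    (hS : ∀ z : ℂ, 0 < z.im → F (-1 / z) = z ^ k * F z)
    (h0 : Tendsto F (comap Complex.im atTop) (𝓝 0)) {z : ℂ} (hz : 0 < z.im) : F z = 0 := by
  have h := rank_zero_iff_forall_zero.mp
    (CuspForm.rank_eq_zero_of_weight_lt_twelve (k := (k : ℤ)) (by exact_mod_cast hk))
    (cuspFormOfGenerators F k hd hT hS h0)
  exact congrArg (fun f : CuspForm 𝒮ℒ k ↦ f ⟨z, hz⟩) h

/-- A cusp form of level one and weight `12` that is not identically zero vanishes nowhere. -/
lemma ne_zero_of_generators {F : ℂ → ℂ}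
    (hd : DifferentiableOn ℂ F {z | 0 < z.im})
    (hT : ∀ z : ℂ, 0 < z.im → F (z + 1) = F z)
    (hS : ∀ z : ℂ, 0 < z.im → F (-1 / z) = z ^ 12 * F z)
    (h0 : Tendsto F (comap Complex.im atTop) (𝓝 0)) {w : ℂ} (hw : 0 < w.im) (hFw : F w ≠ 0)
    {z : ℂ} (hz : 0 < z.im) : F z ≠ 0 := by
  obtain ⟨c, hc⟩ := CuspForm.exists_smul_discriminant_of_weight_eq_twelve
    (cuspFormOfGenerators F 12 hd hT hS h0)
  have h (u : ℂ) (hu : 0 < u.im) : c * ModularForm.discriminant ⟨u, hu⟩ = F u :=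
    congrArg (fun f : CuspForm 𝒮ℒ 12 ↦ f ⟨u, hu⟩) hc
  have hc0 : c ≠ 0 := by
    rintro rfl
    exact hFw (by rw [← h w hw, zero_mul])
  rw [← h z hz]
  exact mul_ne_zero hc0 (discriminant_ne_zero _)

lemma tendsto_E₄ : Tendsto E₄ atImInfty (𝓝 1) := by
  obtain ⟨c, hc, h⟩ := ModularFormClass.exp_decay_sub_atImInfty' E₄
  have hv : valueAtInfty E₄ = 1 := by
    rw [← EisensteinSeries.E_qExpansion_coeff_zero (by norm_num : 3 ≤ 4) ⟨2, rfl⟩]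
    exact (qExpansion_coeff_zero one_pos (ModularFormClass.analyticAt_cuspFunction_zero E₄ one_pos
      one_mem_strictPeriods_SL) (SlashInvariantFormClass.periodic_comp_ofComplex E₄
      one_mem_strictPeriods_SL)).symm
  rw [hv] at h
  have h2 : Tendsto (fun τ : ℍ ↦ Real.exp (-c * τ.im)) atImInfty (𝓝 0) := by
    refine Real.tendsto_exp_atBot.comp ?_
    exact (tendsto_id.const_mul_atTop_of_neg (neg_lt_zero.mpr hc)).comp tendsto_comap
  simpa using (h.trans_tendsto h2).add_const 1

/-- A modular form of level one and weight `4` with value `v` at `i∞` is `v • E₄`. -/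
lemma eq_E₄_of_generators {F : ℂ → ℂ} {v : ℂ}
    (hd : DifferentiableOn ℂ F {z | 0 < z.im})
    (hT : ∀ z : ℂ, 0 < z.im → F (z + 1) = F z)
    (hS : ∀ z : ℂ, 0 < z.im → F (-1 / z) = z ^ 4 * F z)
    (h0 : Tendsto F (comap Complex.im atTop) (𝓝 v)) (τ : ℍ) : F τ = v * E₄ τ := by
  have hES (z : ℂ) (hz : 0 < z.im) :
      (E₄ : ℍ → ℂ) (ofComplex (-1 / z)) = z ^ 4 * E₄ (ofComplex z) := by
    have h : ((E₄ : ℍ → ℂ) ∣[(4 : ℤ)] S) ⟨z, hz⟩ = E₄ ⟨z, hz⟩ :=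
      congrFun (E₄.slash_action_eq' _ ⟨S, rfl⟩) ⟨z, hz⟩
    have hz0 : z ≠ 0 := ne_zero (⟨z, hz⟩ : ℍ)
    have him : 0 < (-1 / z).im := by
      simpa [neg_div, inv_neg] using (⟨z, hz⟩ : ℍ).im_inv_neg_coe_pos
    rw [SlashInvariantForm.slash_S_apply] at h
    rw [ofComplex_apply_of_im_pos him, ofComplex_apply_of_im_pos hz]
    have heq : (⟨-1 / z, him⟩ : ℍ) = ⟨_, (⟨z, hz⟩ : ℍ).im_inv_neg_coe_pos⟩ := by
      ext; simp [neg_div, inv_neg]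
    rw [heq]
    rw [← h, zpow_neg, zpow_ofNat]
    field_simp
  have hET (z : ℂ) (hz : 0 < z.im) :
      (E₄ : ℍ → ℂ) (ofComplex (z + 1)) = E₄ (ofComplex z) := by
    simpa using SlashInvariantFormClass.periodic_comp_ofComplex E₄ one_mem_strictPeriods_SL z
  have hlim : Tendsto (fun z ↦ (E₄ : ℍ → ℂ) (ofComplex z)) (comap Complex.im atTop) (𝓝 1) :=
    tendsto_E₄.comp tendsto_comap_im_ofComplex
  have h := eq_zero_of_generators (F := fun z ↦ F z - v * E₄ (ofComplex z)) (k := 4)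
    (by norm_num) (hd.sub ((UpperHalfPlane.mdifferentiable_iff.mp E₄.holo').const_mul v))
    (fun z hz ↦ by simp only [hT z hz, hET z hz])
    (fun z hz ↦ by simp only [hS z hz, hES z hz]; ring)
    (by simpa using h0.sub (hlim.const_mul v)) τ.im_pos
  simpa [sub_eq_zero] using h

end LevelOne

/-! ### Theta constants: series, transformation laws, limits at `i∞` -/

section ThetaConstants

/-- `θ₂` as a function on `ℂ`. -/
def thetaTwo (z : ℂ) : ℂ := cexp (π * Complex.I * z / 4) * jacobiTheta₂ (z / 2) z

/-- `θ₃` as a function on `ℂ`. -/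
def thetaThree (z : ℂ) : ℂ := jacobiTheta z

/-- `θ₄` as a function on `ℂ`. -/
def thetaFour (z : ℂ) : ℂ := jacobiTheta (z + 1)

lemma neg_one_div_im_pos {z : ℂ} (hz : 0 < z.im) : 0 < (-1 / z).im := by
  simpa [neg_div, inv_neg] using (⟨z, hz⟩ : ℍ).im_inv_neg_coe_pos

lemma add_one_im_pos {z : ℂ} (hz : 0 < z.im) : 0 < (z + 1).im := by simpa using hz

lemma ne_zero_of_im_pos {z : ℂ} (hz : 0 < z.im) : z ≠ 0 := ne_zero (⟨z, hz⟩ : ℍ)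

/-- `n² - n` is even. This controls the effect of `z ↦ z + 1` on each theta series. -/
lemma exp_pi_mul_I_mul_sq (n : ℤ) : cexp (π * Complex.I * n ^ 2) = cexp (π * Complex.I * n) := by
  rw [exp_eq_exp_iff_exists_int]
  obtain ⟨m, hm⟩ := Int.even_mul_pred_self n
  refine ⟨m, ?_⟩
  have : (n : ℂ) * (n - 1) = m + m := by exact_mod_cast hm
  linear_combination (π * Complex.I) * this

lemma thetaFour_eq_jacobiTheta₂ (z : ℂ) : thetaFour z = jacobiTheta₂ (1 / 2) z := by
  refine tsum_congr fun n ↦ ?_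
  rw [jacobiTheta₂_term, mul_add, mul_one, Complex.exp_add, exp_pi_mul_I_mul_sq, ← Complex.exp_add]
  ring_nf

lemma theta3_eq (τ : ℍ) : theta3 τ = thetaThree τ :=
  (jacobiTheta_eq_tsum_nat τ.im_pos).symm

lemma theta4_eq (τ : ℍ) : theta4 τ = thetaFour τ := by
  rw [thetaFour, jacobiTheta_eq_tsum_nat (add_one_im_pos τ.im_pos), theta4]
  congr 3
  ext n
  have h := exp_pi_mul_I_mul_sq (n + 1)
  have h2 : cexp (π * Complex.I * ((n : ℤ) + 1 : ℤ)) = (-1) ^ (n + 1) := by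
    rw [← exp_pi_mul_I, ← Complex.exp_nat_mul]
    push_cast
    ring_nf
  rw [mul_add, mul_one, Complex.exp_add, mul_comm, ← h2, ← h]
  push_cast
  rfl

/-- The terms of index `n` and `-(n + 1)` coincide, which folds the sum over `ℤ` onto `ℕ`. Since `n
(n + 1) = (n + 1/2)² - 1/4`, the prefactor in `thetaTwo` restores the series of `θ₂`. -/
lemma hasSum_jacobiTheta₂_half {z : ℂ} (hz : 0 < z.im) :
    HasSum (fun n : ℕ ↦ 2 * cexp (π * Complex.I * (n * (n + 1)) * z)) (jacobiTheta₂ (z / 2) z) := by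
  convert! (hasSum_jacobiTheta₂_term (z / 2) hz).nat_add_neg_add_one using 2 with n
  rw [jacobiTheta₂_term, jacobiTheta₂_term, two_mul]
  push_cast
  ring_nf

lemma theta2_eq (τ : ℍ) : theta2 τ = thetaTwo τ := by
  rw [thetaTwo, ← (hasSum_jacobiTheta₂_half τ.im_pos).tsum_eq, theta2, ← tsum_mul_left,
    ← tsum_mul_left]
  refine tsum_congr fun n ↦ ?_
  rw [mul_left_comm]
  rw [← Complex.exp_add]
  ring_nf

lemma differentiableAt_jacobiTheta₂_half {z : ℂ} (hz : 0 < z.im) :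
    DifferentiableAt ℂ (fun z ↦ jacobiTheta₂ (z / 2) z) z :=
  (hasFDerivAt_jacobiTheta₂ (z / 2) hz).differentiableAt.comp z
    (f := fun z : ℂ ↦ (z / 2, z)) (by fun_prop)

lemma differentiableAt_thetaTwo {z : ℂ} (hz : 0 < z.im) : DifferentiableAt ℂ thetaTwo z :=
  DifferentiableAt.mul (by fun_prop) (differentiableAt_jacobiTheta₂_half hz)

lemma differentiableAt_thetaThree {z : ℂ} (hz : 0 < z.im) : DifferentiableAt ℂ thetaThree z :=
  differentiableAt_jacobiTheta hz

lemma differentiableAt_thetaFour {z : ℂ} (hz : 0 < z.im) : DifferentiableAt ℂ thetaFour z :=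
  DifferentiableAt.comp z (differentiableAt_jacobiTheta (add_one_im_pos hz))
    (differentiableAt_id.add_const 1)

lemma thetaTwo_add_one (z : ℂ) : thetaTwo (z + 1) = cexp (π * Complex.I / 4) * thetaTwo z := by
  have h : jacobiTheta₂ ((z + 1) / 2) (z + 1) = jacobiTheta₂ (z / 2) z := by
    refine tsum_congr fun n ↦ ?_
    have h1 := exp_pi_mul_I_mul_sq n
    have h2 : cexp (π * Complex.I * n) * cexp (π * Complex.I * n) = 1 := by
      rw [← Complex.exp_add, ← exp_int_mul_two_pi_mul_I n]
      ring_nf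
    rw [jacobiTheta₂_term, jacobiTheta₂_term,
      show 2 * π * Complex.I * n * ((z + 1) / 2) + π * Complex.I * n ^ 2 * (z + 1) =
        π * Complex.I * n + π * Complex.I * n ^ 2 + (2 * π * Complex.I * n * (z / 2) + π * Complex.I * n ^ 2 * z) by ring,
      Complex.exp_add, Complex.exp_add (π * Complex.I * n), h1, h2, one_mul]
  rw [thetaTwo, thetaTwo, h, ← mul_assoc, ← Complex.exp_add]
  ring_nf

lemma thetaThree_add_one (z : ℂ) : thetaThree (z + 1) = thetaFour z := rfl

lemma thetaFour_add_one (z : ℂ) : thetaFour (z + 1) = thetaThree z := by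
  rw [thetaFour, thetaThree, ← jacobiTheta_two_add z]
  ring_nf

lemma cpow_half_pow_four (z : ℂ) : ((-Complex.I * z) ^ (1 / 2 : ℂ)) ^ 4 = -z ^ 2 := by
  have h : ((-Complex.I * z) ^ (1 / 2 : ℂ)) ^ 2 = -Complex.I * z := by
    rw [one_div]
    exact_mod_cast cpow_nat_inv_pow (-Complex.I * z) two_ne_zero
  rw [show 4 = 2 * 2 from rfl, pow_mul, h, mul_pow, neg_sq, I_sq]
  ring

/-- The functional equation carries the factor `(-i z)^(1/2)`; its fourth power is `-z ^ 2`, so no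
branch survives. -/
lemma thetaTwo_neg_one_div {z : ℂ} (hz : 0 < z.im) :
    thetaTwo (-1 / z) ^ 4 = -z ^ 2 * thetaFour z ^ 4 := by
  have hz0 := ne_zero_of_im_pos hz
  have h0 : (-Complex.I * z) ^ (1 / 2 : ℂ) ≠ 0 := by simp [cpow_eq_zero_iff, hz0]
  have h := jacobiTheta₂_functional_equation (1 / 2) z
  rw [← jacobiTheta₂_neg_left (1 / 2 / z), ← thetaFour_eq_jacobiTheta₂,
    show -(1 / 2 / z) = -1 / z / 2 by ring,
    show -π * Complex.I * (1 / 2) ^ 2 / z = π * Complex.I * (-1 / z) / 4 by ring, mul_assoc, ← thetaTwo] at h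
  rw [h, ← cpow_half_pow_four, mul_pow, div_pow]
  field_simp

lemma thetaThree_neg_one_div {z : ℂ} (hz : 0 < z.im) :
    thetaThree (-1 / z) ^ 4 = -z ^ 2 * thetaThree z ^ 4 := by
  have hz0 := ne_zero_of_im_pos hz
  have h0 : (-Complex.I * z) ^ (1 / 2 : ℂ) ≠ 0 := by simp [cpow_eq_zero_iff, hz0]
  have h := jacobiTheta₂_functional_equation 0 z
  rw [zero_div, ← jacobiTheta_eq_jacobiTheta₂, ← jacobiTheta_eq_jacobiTheta₂] at h
  rw [thetaThree, thetaThree, h, ← cpow_half_pow_four, mul_pow, mul_pow, div_pow]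
  simp
  field_simp

lemma thetaFour_neg_one_div {z : ℂ} (hz : 0 < z.im) :
    thetaFour (-1 / z) ^ 4 = -z ^ 2 * thetaTwo z ^ 4 := by
  have hz0 := ne_zero_of_im_pos hz
  have h := thetaTwo_neg_one_div (neg_one_div_im_pos hz)
  rw [show -1 / (-1 / z) = z by field_simp] at h
  rw [h]
  field_simp

lemma tendsto_exp_mul_im {c : ℝ} (hc : c < 0) :
    Tendsto (fun z : ℂ ↦ Real.exp (c * z.im)) (comap Complex.im atTop) (𝓝 0) :=
  Real.tendsto_exp_atBot.comp ((tendsto_id.const_mul_atTop_of_neg hc).comp tendsto_comap)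

lemma tendsto_thetaThree : Tendsto thetaThree (comap Complex.im atTop) (𝓝 1) := by
  have h := isBigO_at_im_infty_jacobiTheta_sub_one.trans_tendsto
    (tendsto_exp_mul_im (neg_lt_zero.mpr Real.pi_pos))
  simpa [thetaThree, Function.comp_def] using! h.add_const 1

lemma tendsto_add_one_comap_im : Tendsto (fun z : ℂ ↦ z + 1) (comap Complex.im atTop) (comap Complex.im atTop) := by
  rw [tendsto_comap_iff]
  exact tendsto_comap.congr fun z ↦ by simp

lemma tendsto_thetaFour : Tendsto thetaFour (comap Complex.im atTop) (𝓝 1) :=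
  tendsto_thetaThree.comp tendsto_add_one_comap_im

lemma norm_exp_pi_mul_I_mul (r : ℝ) (z : ℂ) : ‖cexp (π * Complex.I * r * z)‖ = Real.exp (-π * r * z.im) := by
  rw [Complex.norm_exp]
  congr 1
  simp

lemma tendsto_exp_pi_mul_I_mul {r : ℝ} (hr : 0 < r) :
    Tendsto (fun z ↦ cexp (π * Complex.I * r * z)) (comap Complex.im atTop) (𝓝 0) := by
  rw [tendsto_zero_iff_norm_tendsto_zero]
  simp_rw [norm_exp_pi_mul_I_mul]
  exact tendsto_exp_mul_im (by nlinarith [Real.pi_pos])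

/-- Dominated convergence: for `Im z ≥ 1` the bound `n ≤ n (n + 1) Im z` gives a geometric majorant,
and only the term `n = 0` survives in the limit. -/
lemma tendsto_jacobiTheta₂_half :
    Tendsto (fun z ↦ jacobiTheta₂ (z / 2) z) (comap Complex.im atTop) (𝓝 2) := by
  have hev : ∀ᶠ z : ℂ in comap Complex.im atTop, 1 ≤ z.im :=
    tendsto_comap.eventually (eventually_ge_atTop 1)
  have h := tendsto_tsum_of_dominated_convergence (𝓕 := comap Complex.im atTop)
    (f := fun (z : ℂ) (n : ℕ) ↦ 2 * cexp (π * Complex.I * (n * (n + 1)) * z))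
    (g := fun n : ℕ ↦ if n = 0 then 2 else 0) (bound := fun n : ℕ ↦ 2 * Real.exp (-π) ^ n)
    ((summable_geometric_of_lt_one (Real.exp_nonneg _)
      (Real.exp_lt_one_iff.mpr (neg_lt_zero.mpr Real.pi_pos))).mul_left 2) ?_ ?_
  · rw [tsum_ite_eq] at h
    refine h.congr' ?_
    filter_upwards [hev] with z hz
    exact (hasSum_jacobiTheta₂_half (by linarith)).tsum_eq
  · intro n
    rcases eq_or_ne n 0 with rfl | hn
    · simpa using tendsto_const_nhds
    · have hn' : (0 : ℝ) < n := by positivity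
      simpa [hn] using (tendsto_exp_pi_mul_I_mul (r := n * (n + 1)) (by positivity)).const_mul 2
  · filter_upwards [hev] with z hz n
    have h := norm_exp_pi_mul_I_mul (n * (n + 1)) z
    push_cast at h
    rw [norm_mul, h, ← Real.exp_nat_mul]
    simp only [Complex.norm_ofNat]
    refine mul_le_mul_of_nonneg_left (Real.exp_le_exp.mpr ?_) zero_le_two
    have h1 : (n : ℝ) ≤ n * (n + 1) := by nlinarith [sq_nonneg (n : ℝ)]
    have h2 : (n : ℝ) ≤ n * (n + 1) * z.im := by nlinarith [(Nat.cast_nonneg n : (0 : ℝ) ≤ n)]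
    nlinarith [Real.pi_pos]

lemma tendsto_thetaTwo : Tendsto thetaTwo (comap Complex.im atTop) (𝓝 0) := by
  have h := (tendsto_exp_pi_mul_I_mul (r := 1 / 4) (by norm_num)).mul tendsto_jacobiTheta₂_half
  rw [zero_mul] at h
  refine h.congr fun z ↦ ?_
  rw [thetaTwo]
  push_cast
  ring_nf

end ThetaConstants

/-! ### Non-vanishing, Jacobi's identity and `E₄` -/

section Identities

lemma thetaTwo_add_one_pow_four (z : ℂ) : thetaTwo (z + 1) ^ 4 = -thetaTwo z ^ 4 := by
  rw [thetaTwo_add_one, mul_pow, ← Complex.exp_nat_mul,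
    show ((4 : ℕ) : ℂ) * (π * Complex.I / 4) = π * Complex.I by push_cast; ring, exp_pi_mul_I]
  ring

lemma differentiableOn_of_forall {F : ℂ → ℂ} (h : ∀ z : ℂ, 0 < z.im → DifferentiableAt ℂ F z) :
    DifferentiableOn ℂ F {z | 0 < z.im} :=
  fun z hz ↦ (h z hz).differentiableWithinAt

/-- The product of the three fourth powers has weight 6 up to sign under `T` and `S`; squaring
removes the sign and gives a cusp form of weight 12. It is nonzero high up in the half-plane, hence
a nonzero multiple of the discriminant. -/
lemma theta_mul_ne_zero {z : ℂ} (hz : 0 < z.im) :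
    thetaTwo z * thetaThree z * thetaFour z ≠ 0 := by
  have key : (thetaTwo z ^ 4 * thetaThree z ^ 4 * thetaFour z ^ 4) ^ 2 ≠ 0 := by
    have hev : ∀ᶠ w in comap Complex.im atTop, 0 < w.im ∧ jacobiTheta₂ (w / 2) w ≠ 0 ∧
        thetaThree w ≠ 0 ∧ thetaFour w ≠ 0 :=
      (tendsto_comap.eventually (eventually_gt_atTop 0)).and <|
        (tendsto_jacobiTheta₂_half.eventually_ne two_ne_zero).and <|
        (tendsto_thetaThree.eventually_ne one_ne_zero).and <|
        tendsto_thetaFour.eventually_ne one_ne_zero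
    have : (comap Complex.im atTop : Filter ℂ).NeBot := by
      refine comap_neBot_iff_frequently.mpr (Frequently.of_forall fun y ↦ ⟨y * Complex.I, by simp⟩)
    obtain ⟨w, hw, h2, h3, h4⟩ := hev.exists
    refine ne_zero_of_generators
      (F := fun z ↦ (thetaTwo z ^ 4 * thetaThree z ^ 4 * thetaFour z ^ 4) ^ 2)
      (differentiableOn_of_forall fun z hz ↦ ?_) (fun z _ ↦ ?_) (fun z hz ↦ ?_) ?_ hw ?_ hz
    · exact ((((differentiableAt_thetaTwo hz).pow 4).mul
        ((differentiableAt_thetaThree hz).pow 4)).mul ((differentiableAt_thetaFour hz).pow 4)).pow 2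
    · simp only [thetaTwo_add_one_pow_four, thetaThree_add_one, thetaFour_add_one]
      ring
    · simp only [thetaTwo_neg_one_div hz, thetaThree_neg_one_div hz, thetaFour_neg_one_div hz]
      ring
    · simpa using (((tendsto_thetaTwo.pow 4).mul (tendsto_thetaThree.pow 4)).mul
        (tendsto_thetaFour.pow 4)).pow 2
    · simp [thetaTwo, h2, h3, h4]
  intro h
  apply key
  rw [← mul_pow, ← mul_pow, h]
  simp

lemma thetaTwo_ne_zero {z : ℂ} (hz : 0 < z.im) : thetaTwo z ≠ 0 :=
  left_ne_zero_of_mul (left_ne_zero_of_mul (theta_mul_ne_zero hz))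

lemma thetaThree_ne_zero {z : ℂ} (hz : 0 < z.im) : thetaThree z ≠ 0 :=
  right_ne_zero_of_mul (left_ne_zero_of_mul (theta_mul_ne_zero hz))

lemma thetaFour_ne_zero {z : ℂ} (hz : 0 < z.im) : thetaFour z ≠ 0 :=
  right_ne_zero_of_mul (theta_mul_ne_zero hz)

/-- Jacobi's identity `θ₃⁴ = θ₂⁴ + θ₄⁴`. -/
lemma jacobi_identity {z : ℂ} (hz : 0 < z.im) :
    thetaThree z ^ 4 = thetaTwo z ^ 4 + thetaFour z ^ 4 := by
  -- The difference of the two sides changes sign under `T`, so its square is used: a weight 4 cusp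
  -- form.
  have h := eq_zero_of_generators (k := 4)
    (F := fun z ↦ (thetaThree z ^ 4 - thetaTwo z ^ 4 - thetaFour z ^ 4) ^ 2) (by norm_num)
    (differentiableOn_of_forall fun z hz ↦ ((((differentiableAt_thetaThree hz).pow 4).sub
      ((differentiableAt_thetaTwo hz).pow 4)).sub ((differentiableAt_thetaFour hz).pow 4)).pow 2)
    (fun z _ ↦ by
      simp only [thetaTwo_add_one_pow_four, thetaThree_add_one, thetaFour_add_one]
      ring)
    (fun z hz ↦ by
      simp only [thetaTwo_neg_one_div hz, thetaThree_neg_one_div hz, thetaFour_neg_one_div hz]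
      ring)
    (by simpa using (((tendsto_thetaThree.pow 4).sub (tendsto_thetaTwo.pow 4)).sub
        (tendsto_thetaFour.pow 4)).pow 2) hz
  linear_combination pow_eq_zero_iff two_ne_zero |>.mp h

/-- `2 E₄ = θ₂⁸ + θ₃⁸ + θ₄⁸`. -/
lemma two_mul_E₄ (τ : ℍ) :
    thetaTwo τ ^ 8 + thetaThree τ ^ 8 + thetaFour τ ^ 8 = 2 * E₄ τ := by
  -- The eighth powers are permuted without signs; the value at `i∞` is `0 + 1 + 1`.
  have h := eq_E₄_of_generators (v := 2)
    (F := fun z ↦ (thetaTwo z ^ 4) ^ 2 + (thetaThree z ^ 4) ^ 2 + (thetaFour z ^ 4) ^ 2)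
    (differentiableOn_of_forall fun z hz ↦ ((((differentiableAt_thetaTwo hz).pow 4).pow 2).add
      (((differentiableAt_thetaThree hz).pow 4).pow 2)).add
      (((differentiableAt_thetaFour hz).pow 4).pow 2))
    (fun z _ ↦ by
      simp only [thetaTwo_add_one_pow_four, thetaThree_add_one, thetaFour_add_one]
      ring)
    (fun z hz ↦ by
      simp only [thetaTwo_neg_one_div hz, thetaThree_neg_one_div hz, thetaFour_neg_one_div hz]
      ring)
    (by
      have := (((tendsto_thetaTwo.pow 4).pow 2).add ((tendsto_thetaThree.pow 4).pow 2)).add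
        ((tendsto_thetaFour.pow 4).pow 2)
      norm_num at this
      exact this) τ
  linear_combination h

end Identities

/-! ### Logarithmic derivatives: behaviour at `i∞` and under `z ↦ -1 / z` -/

section LogDeriv

/-- The derivative of a holomorphic function with a limit at `i∞` tends to zero there. -/
lemma tendsto_deriv_comap_im {F : ℂ → ℂ} {v : ℂ}
    (hd : ∀ z : ℂ, 0 < z.im → DifferentiableAt ℂ F z)
    (h : Tendsto F (comap Complex.im atTop) (𝓝 v)) : Tendsto (deriv F) (comap Complex.im atTop) (𝓝 0) := by
  rw [Metric.tendsto_nhds]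
  intro ε hε
  have h1 : ∀ᶠ y in (atTop : Filter ℝ), ∀ w : ℂ, w.im = y → dist (F w) v < ε / 2 :=
    eventually_comap.mp (Metric.tendsto_nhds.mp h (ε / 2) (half_pos hε))
  obtain ⟨M, hM⟩ := eventually_atTop.mp h1
  filter_upwards [tendsto_comap.eventually (eventually_gt_atTop (max M 0 + 1))] with z hz
  have him (w : ℂ) (hw : w ∈ Metric.closedBall z 1) : max M 0 < w.im := by
    have h2 : |(w - z).im| ≤ 1 := (abs_im_le_norm _).trans (by simpa [dist_eq_norm] using hw)
    have h3 := (abs_le.mp h2).1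
    rw [sub_im] at h3
    linarith
  have hdiff : DifferentiableOn ℂ (fun w ↦ F w - v) (Metric.closedBall z 1) := fun w hw ↦
    ((hd w ((le_max_right _ _).trans_lt (him w hw))).sub_const v).differentiableWithinAt
  -- Cauchy's estimate on the unit disc, which stays in the region where `F` is close to `v`.
  have h4 := norm_deriv_le_of_forall_mem_sphere_norm_le one_pos
    (hdiff.diffContOnCl_ball subset_rfl) (C := ε / 2) fun w hw ↦ by
      have := hM w.im ((le_max_left _ _).trans (him w (Metric.sphere_subset_closedBall hw)).le) w rfl
      rw [dist_eq_norm] at this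
      exact this.le
  rw [deriv_sub_const] at h4
  rw [dist_zero_right]
  linarith

lemma differentiableAt_logDeriv {F : ℂ → ℂ} (hd : ∀ z : ℂ, 0 < z.im → DifferentiableAt ℂ F z)
    {z : ℂ} (hz : 0 < z.im) (h0 : F z ≠ 0) : DifferentiableAt ℂ (logDeriv F) z :=
  DifferentiableAt.div (((differentiableOn_of_forall hd).deriv
    isOpen_upperHalfPlaneSet).differentiableAt (isOpen_upperHalfPlaneSet.mem_nhds hz)) (hd z hz) h0

lemma logDeriv_add_one {F G : ℂ → ℂ} {c : ℂ} (hc : c ≠ 0) (h : ∀ z, F (z + 1) = c * G z) (z : ℂ) :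
    logDeriv F (z + 1) = logDeriv G z := by
  have h1 : deriv F (z + 1) = c * deriv G z := by
    rw [← deriv_comp_add_const F 1 z, funext h, deriv_const_mul_field']
  rw [logDeriv_apply, logDeriv_apply, h1, h, mul_div_mul_left _ _ hc]

lemma hasDerivAt_neg_one_div {z : ℂ} (hz : z ≠ 0) :
    HasDerivAt (fun w : ℂ ↦ -1 / w) (1 / z ^ 2) z := by
  simpa [div_eq_mul_inv] using (hasDerivAt_inv hz).const_mul (-1 : ℂ)

/-- Take logarithmic derivatives of the fourth-power relation: `z ^ 2` contributes `2 / z`, which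
becomes `z / 2` after multiplying by `z ^ 2 / 4`. -/
lemma logDeriv_neg_one_div {F G : ℂ → ℂ} (hF : ∀ z : ℂ, 0 < z.im → DifferentiableAt ℂ F z)
    (hG : ∀ z : ℂ, 0 < z.im → DifferentiableAt ℂ G z) (hG0 : ∀ z : ℂ, 0 < z.im → G z ≠ 0)
    (h : ∀ z : ℂ, 0 < z.im → F (-1 / z) ^ 4 = -z ^ 2 * G z ^ 4) {z : ℂ} (hz : 0 < z.im) :
    logDeriv F (-1 / z) = z ^ 2 * logDeriv G z + z / 2 := by
  have hz0 := ne_zero_of_im_pos hz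
  have hGz := hG0 z hz
  have hFz : F (-1 / z) ≠ 0 := by
    intro h0
    have := h z hz
    rw [h0] at this
    simp [hz0, hGz] at this
  have h1 := ((hF _ (neg_one_div_im_pos hz)).hasDerivAt.comp z (hasDerivAt_neg_one_div hz0)).pow 4
  have h2 := ((hasDerivAt_id z).pow 2).neg.mul ((hG z hz).hasDerivAt.pow 4)
  have heq : (fun w ↦ (F ∘ fun w : ℂ ↦ -1 / w) w ^ 4) =ᶠ[𝓝 z] fun w ↦ -w ^ 2 * G w ^ 4 := by
    filter_upwards [isOpen_upperHalfPlaneSet.mem_nhds hz] with w hw using h w hw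
  have h3 := (h1.congr_of_eventuallyEq heq.symm).unique h2
  simp only [Function.comp_apply, Pi.neg_apply, Pi.pow_apply, id, Nat.cast_ofNat, Nat.add_one_sub_one] at h3
  have h4 := h z hz
  have hzz : z ^ 2 * (1 / z ^ 2) = 1 := by field_simp
  have h5 : -2 * G z ^ 3 * (2 * G z * deriv F (-1 / z)) =
      -2 * G z ^ 3 * (F (-1 / z) * (z * G z + 2 * z ^ 2 * deriv G z)) := by
    linear_combination F (-1 / z) * h3 - 4 * deriv F (-1 / z) * (1 / z ^ 2) * h4 +
      4 * deriv F (-1 / z) * G z ^ 4 * hzz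
  have h6 := mul_left_cancel₀ (mul_ne_zero (by norm_num) (pow_ne_zero 3 hGz)) h5
  rw [logDeriv_apply, logDeriv_apply, div_eq_iff hFz]
  generalize -1 / z = w at h6
  field_simp
  linear_combination h6

end LogDeriv

/-! ### The Halphen system and Ramanujan's equation -/

section Halphen

lemma logDeriv_thetaTwo_add_one (z : ℂ) : logDeriv thetaTwo (z + 1) = logDeriv thetaTwo z :=
  logDeriv_add_one (Complex.exp_ne_zero _) thetaTwo_add_one z

lemma logDeriv_thetaThree_add_one (z : ℂ) : logDeriv thetaThree (z + 1) = logDeriv thetaFour z :=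
  logDeriv_add_one one_ne_zero (fun z ↦ by rw [thetaThree_add_one, one_mul]) z

lemma logDeriv_thetaFour_add_one (z : ℂ) : logDeriv thetaFour (z + 1) = logDeriv thetaThree z :=
  logDeriv_add_one one_ne_zero (fun z ↦ by rw [thetaFour_add_one, one_mul]) z

lemma logDeriv_thetaTwo_neg_one_div {z : ℂ} (hz : 0 < z.im) :
    logDeriv thetaTwo (-1 / z) = z ^ 2 * logDeriv thetaFour z + z / 2 :=
  logDeriv_neg_one_div (fun _ ↦ differentiableAt_thetaTwo) (fun _ ↦ differentiableAt_thetaFour)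
    (fun _ ↦ thetaFour_ne_zero) (fun _ ↦ thetaTwo_neg_one_div) hz

lemma logDeriv_thetaThree_neg_one_div {z : ℂ} (hz : 0 < z.im) :
    logDeriv thetaThree (-1 / z) = z ^ 2 * logDeriv thetaThree z + z / 2 :=
  logDeriv_neg_one_div (fun _ ↦ differentiableAt_thetaThree) (fun _ ↦ differentiableAt_thetaThree)
    (fun _ ↦ thetaThree_ne_zero) (fun _ ↦ thetaThree_neg_one_div) hz

lemma logDeriv_thetaFour_neg_one_div {z : ℂ} (hz : 0 < z.im) :
    logDeriv thetaFour (-1 / z) = z ^ 2 * logDeriv thetaTwo z + z / 2 :=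
  logDeriv_neg_one_div (fun _ ↦ differentiableAt_thetaFour) (fun _ ↦ differentiableAt_thetaTwo)
    (fun _ ↦ thetaTwo_ne_zero) (fun _ ↦ thetaFour_neg_one_div) hz

lemma differentiableAt_logDeriv_thetaTwo {z : ℂ} (hz : 0 < z.im) :
    DifferentiableAt ℂ (logDeriv thetaTwo) z :=
  differentiableAt_logDeriv (fun _ ↦ differentiableAt_thetaTwo) hz (thetaTwo_ne_zero hz)

lemma differentiableAt_logDeriv_thetaThree {z : ℂ} (hz : 0 < z.im) :
    DifferentiableAt ℂ (logDeriv thetaThree) z :=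
  differentiableAt_logDeriv (fun _ ↦ differentiableAt_thetaThree) hz (thetaThree_ne_zero hz)

lemma differentiableAt_logDeriv_thetaFour {z : ℂ} (hz : 0 < z.im) :
    DifferentiableAt ℂ (logDeriv thetaFour) z :=
  differentiableAt_logDeriv (fun _ ↦ differentiableAt_thetaFour) hz (thetaFour_ne_zero hz)

/-- The logarithmic derivative of a holomorphic function with a nonzero limit at `i∞` tends to
zero there. -/
lemma tendsto_logDeriv_comap_im {F : ℂ → ℂ} {v : ℂ} (hv : v ≠ 0)
    (hd : ∀ z : ℂ, 0 < z.im → DifferentiableAt ℂ F z)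
    (h : Tendsto F (comap Complex.im atTop) (𝓝 v)) : Tendsto (logDeriv F) (comap Complex.im atTop) (𝓝 0) := by
  have := (tendsto_deriv_comap_im hd h).div h hv
  rwa [zero_div] at this

/-- The limit comes entirely from the exponential prefactor, as the remaining factor tends to `2 ≠
0`. -/
lemma tendsto_logDeriv_thetaTwo :
    Tendsto (logDeriv thetaTwo) (comap Complex.im atTop) (𝓝 (π * Complex.I / 4)) := by
  have h := (tendsto_logDeriv_comap_im two_ne_zero (fun _ ↦ differentiableAt_jacobiTheta₂_half)
    tendsto_jacobiTheta₂_half).const_add (π * Complex.I / 4)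
  rw [add_zero] at h
  refine h.congr' ?_
  filter_upwards [tendsto_comap.eventually (eventually_gt_atTop 0)] with z hz
  have hexp : HasDerivAt (fun w : ℂ ↦ cexp (π * Complex.I * w / 4)) (cexp (π * Complex.I * z / 4) * (π * Complex.I / 4)) z := by
    have := (((hasDerivAt_id z).const_mul (π * Complex.I)).div_const 4).cexp
    simpa using this
  have h0 : jacobiTheta₂ (z / 2) z ≠ 0 := right_ne_zero_of_mul (thetaTwo_ne_zero hz)
  have h1 := logDeriv_mul (f := fun w : ℂ ↦ cexp (π * Complex.I * w / 4))
    (g := fun w : ℂ ↦ jacobiTheta₂ (w / 2) w) z (Complex.exp_ne_zero _) h0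
    hexp.differentiableAt (differentiableAt_jacobiTheta₂_half hz)
  rw [show thetaTwo = fun w ↦ cexp (π * Complex.I * w / 4) * jacobiTheta₂ (w / 2) w from rfl, h1,
    logDeriv_apply (fun w : ℂ ↦ cexp (π * Complex.I * w / 4)), hexp.deriv,
    mul_div_cancel_left₀ _ (Complex.exp_ne_zero _)]

lemma tendsto_logDeriv_thetaThree : Tendsto (logDeriv thetaThree) (comap Complex.im atTop) (𝓝 0) :=
  tendsto_logDeriv_comap_im one_ne_zero (fun _ ↦ differentiableAt_thetaThree) tendsto_thetaThree

lemma tendsto_logDeriv_thetaFour : Tendsto (logDeriv thetaFour) (comap Complex.im atTop) (𝓝 0) :=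
  tendsto_logDeriv_comap_im one_ne_zero (fun _ ↦ differentiableAt_thetaFour) tendsto_thetaFour

/-- The mean of the logarithmic derivatives of the three theta constants; it equals
`π i E₂ / 12`. -/
def meanLogDeriv (z : ℂ) : ℂ :=
  (logDeriv thetaTwo z + logDeriv thetaThree z + logDeriv thetaFour z) / 3

lemma differentiableAt_meanLogDeriv {z : ℂ} (hz : 0 < z.im) :
    DifferentiableAt ℂ meanLogDeriv z :=
  (((differentiableAt_logDeriv_thetaTwo hz).add (differentiableAt_logDeriv_thetaThree hz)).add
    (differentiableAt_logDeriv_thetaFour hz)).div_const 3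

lemma meanLogDeriv_add_one (z : ℂ) : meanLogDeriv (z + 1) = meanLogDeriv z := by
  simp only [meanLogDeriv, logDeriv_thetaTwo_add_one, logDeriv_thetaThree_add_one,
    logDeriv_thetaFour_add_one]
  ring

lemma meanLogDeriv_neg_one_div {z : ℂ} (hz : 0 < z.im) :
    meanLogDeriv (-1 / z) = z ^ 2 * meanLogDeriv z + z / 2 := by
  simp only [meanLogDeriv, logDeriv_thetaTwo_neg_one_div hz, logDeriv_thetaThree_neg_one_div hz,
    logDeriv_thetaFour_neg_one_div hz]
  ring

lemma tendsto_meanLogDeriv : Tendsto meanLogDeriv (comap Complex.im atTop) (𝓝 (π * Complex.I / 12)) := by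
  have h : Tendsto meanLogDeriv (comap Complex.im atTop) (𝓝 ((π * Complex.I / 4 + 0 + 0) / 3)) :=
    ((tendsto_logDeriv_thetaTwo.add tendsto_logDeriv_thetaThree).add
      tendsto_logDeriv_thetaFour).div_const 3
  convert h using 2
  ring

/-- The three defects `f₂, f₃, f₄` vanish at `i∞` and are permuted by `T` and, with the factor `z ^
2`, by `S`; subtracting the mean cancels the anomaly `z / 2`. Their elementary symmetric functions
are therefore level-one cusp forms of weights 2, 4, 6. The first is zero by construction, the others
by weight. -/
lemma logDeriv_meanLogDeriv_identities {z : ℂ} (hz : 0 < z.im) :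
    logDeriv thetaTwo z =
        meanLogDeriv z + π * Complex.I / 12 * (thetaThree z ^ 4 + thetaFour z ^ 4) ∧
      logDeriv thetaThree z =
        meanLogDeriv z + π * Complex.I / 12 * (thetaTwo z ^ 4 - thetaFour z ^ 4) ∧
      logDeriv thetaFour z =
        meanLogDeriv z - π * Complex.I / 12 * (thetaTwo z ^ 4 + thetaThree z ^ 4) := by
  let f₂ (z : ℂ) : ℂ :=
    logDeriv thetaTwo z - meanLogDeriv z - π * Complex.I / 12 * (thetaThree z ^ 4 + thetaFour z ^ 4)
  let f₃ (z : ℂ) : ℂ :=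
    logDeriv thetaThree z - meanLogDeriv z - π * Complex.I / 12 * (thetaTwo z ^ 4 - thetaFour z ^ 4)
  let f₄ (z : ℂ) : ℂ :=
    logDeriv thetaFour z - meanLogDeriv z + π * Complex.I / 12 * (thetaTwo z ^ 4 + thetaThree z ^ 4)
  have d₂ (z : ℂ) (hz : 0 < z.im) : DifferentiableAt ℂ f₂ z :=
    ((differentiableAt_logDeriv_thetaTwo hz).sub (differentiableAt_meanLogDeriv hz)).sub
      ((((differentiableAt_thetaThree hz).pow 4).add
        ((differentiableAt_thetaFour hz).pow 4)).const_mul _)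
  have d₃ (z : ℂ) (hz : 0 < z.im) : DifferentiableAt ℂ f₃ z :=
    ((differentiableAt_logDeriv_thetaThree hz).sub (differentiableAt_meanLogDeriv hz)).sub
      ((((differentiableAt_thetaTwo hz).pow 4).sub
        ((differentiableAt_thetaFour hz).pow 4)).const_mul _)
  have d₄ (z : ℂ) (hz : 0 < z.im) : DifferentiableAt ℂ f₄ z :=
    ((differentiableAt_logDeriv_thetaFour hz).sub (differentiableAt_meanLogDeriv hz)).add
      ((((differentiableAt_thetaTwo hz).pow 4).add
        ((differentiableAt_thetaThree hz).pow 4)).const_mul _)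
  have T₂ (z : ℂ) : f₂ (z + 1) = f₂ z := by
    simp only [f₂, logDeriv_thetaTwo_add_one, meanLogDeriv_add_one, thetaThree_add_one,
      thetaFour_add_one]
    ring
  have T₃ (z : ℂ) : f₃ (z + 1) = f₄ z := by
    simp only [f₃, f₄, logDeriv_thetaThree_add_one, meanLogDeriv_add_one,
      thetaTwo_add_one_pow_four, thetaFour_add_one]
    ring
  have T₄ (z : ℂ) : f₄ (z + 1) = f₃ z := by
    simp only [f₃, f₄, logDeriv_thetaFour_add_one, meanLogDeriv_add_one,
      thetaTwo_add_one_pow_four, thetaThree_add_one]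
    ring
  have S₂ (z : ℂ) (hz : 0 < z.im) : f₂ (-1 / z) = z ^ 2 * f₄ z := by
    simp only [f₂, f₄, logDeriv_thetaTwo_neg_one_div hz, meanLogDeriv_neg_one_div hz,
      thetaThree_neg_one_div hz, thetaFour_neg_one_div hz]
    ring
  have S₃ (z : ℂ) (hz : 0 < z.im) : f₃ (-1 / z) = z ^ 2 * f₃ z := by
    simp only [f₃, logDeriv_thetaThree_neg_one_div hz, meanLogDeriv_neg_one_div hz,
      thetaTwo_neg_one_div hz, thetaFour_neg_one_div hz]
    ring
  have S₄ (z : ℂ) (hz : 0 < z.im) : f₄ (-1 / z) = z ^ 2 * f₂ z := by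
    simp only [f₂, f₄, logDeriv_thetaFour_neg_one_div hz, meanLogDeriv_neg_one_div hz,
      thetaTwo_neg_one_div hz, thetaThree_neg_one_div hz]
    ring
  have L₂ : Tendsto f₂ (comap Complex.im atTop) (𝓝 0) := by
    have h := (tendsto_logDeriv_thetaTwo.sub tendsto_meanLogDeriv).sub
      (((tendsto_thetaThree.pow 4).add (tendsto_thetaFour.pow 4)).const_mul (π * Complex.I / 12))
    convert h using 2
    ring
  have L₃ : Tendsto f₃ (comap Complex.im atTop) (𝓝 0) := by
    have h := (tendsto_logDeriv_thetaThree.sub tendsto_meanLogDeriv).sub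
      (((tendsto_thetaTwo.pow 4).sub (tendsto_thetaFour.pow 4)).const_mul (π * Complex.I / 12))
    convert h using 2
    ring
  have L₄ : Tendsto f₄ (comap Complex.im atTop) (𝓝 0) := by
    have h := (tendsto_logDeriv_thetaFour.sub tendsto_meanLogDeriv).add
      (((tendsto_thetaTwo.pow 4).add (tendsto_thetaThree.pow 4)).const_mul (π * Complex.I / 12))
    convert h using 2
    ring
  have e₁ : f₂ z + f₃ z + f₄ z = 0 := by
    simp only [f₂, f₃, f₄, meanLogDeriv]
    ring
  have e₂ : f₂ z * f₃ z + f₃ z * f₄ z + f₄ z * f₂ z = 0 :=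
    eq_zero_of_generators (k := 4) (F := fun z ↦ f₂ z * f₃ z + f₃ z * f₄ z + f₄ z * f₂ z)
      (by norm_num)
      (differentiableOn_of_forall fun z hz ↦ (((d₂ z hz).mul (d₃ z hz)).add
        ((d₃ z hz).mul (d₄ z hz))).add ((d₄ z hz).mul (d₂ z hz)))
      (fun z _ ↦ by simp only [T₂, T₃, T₄]; ring)
      (fun z hz ↦ by simp only [S₂ z hz, S₃ z hz, S₄ z hz]; ring)
      (by simpa using ((L₂.mul L₃).add (L₃.mul L₄)).add (L₄.mul L₂)) hz
  have e₃ : f₂ z * f₃ z * f₄ z = 0 :=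
    eq_zero_of_generators (k := 6) (F := fun z ↦ f₂ z * f₃ z * f₄ z) (by norm_num)
      (differentiableOn_of_forall fun z hz ↦ ((d₂ z hz).mul (d₃ z hz)).mul (d₄ z hz))
      (fun z _ ↦ by simp only [T₂, T₃, T₄]; ring)
      (fun z hz ↦ by simp only [S₂ z hz, S₃ z hz, S₄ z hz]; ring)
      (by simpa using (L₂.mul L₃).mul L₄) hz
  -- With all symmetric functions zero, each defect is a root of `x ^ 3`.
  have cube (x : ℂ) (hx : (x - f₂ z) * (x - f₃ z) * (x - f₄ z) = 0) : x = 0 := by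
    refine (pow_eq_zero_iff (n := 3) (by norm_num)).mp ?_
    linear_combination hx + x ^ 2 * e₁ - x * e₂ + e₃
  have h₂ : f₂ z = 0 := cube _ (by ring)
  have h₃ : f₃ z = 0 := cube _ (by ring)
  have h₄ : f₄ z = 0 := cube _ (by ring)
  refine ⟨?_, ?_, ?_⟩
  · linear_combination h₂
  · linear_combination h₃
  · linear_combination h₄

/-- Ramanujan's equation for `E₂`, in terms of `meanLogDeriv`. -/
lemma deriv_meanLogDeriv (τ : ℍ) :
    deriv meanLogDeriv τ = 2 * meanLogDeriv τ ^ 2 + π ^ 2 / 72 * E₄ τ := by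
  have hdd (z : ℂ) (hz : 0 < z.im) : DifferentiableAt ℂ (deriv meanLogDeriv) z :=
    ((differentiableOn_of_forall fun _ ↦ differentiableAt_meanLogDeriv).deriv
      isOpen_upperHalfPlaneSet).differentiableAt (isOpen_upperHalfPlaneSet.mem_nhds hz)
  have hT (z : ℂ) : deriv meanLogDeriv (z + 1) = deriv meanLogDeriv z := by
    rw [← deriv_comp_add_const, funext meanLogDeriv_add_one]
  have hS (z : ℂ) (hz : 0 < z.im) : deriv meanLogDeriv (-1 / z) =
      z ^ 2 * (z ^ 2 * deriv meanLogDeriv z + 2 * z * meanLogDeriv z + 1 / 2) := by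
    have hz0 := ne_zero_of_im_pos hz
    have h1 := (differentiableAt_meanLogDeriv (neg_one_div_im_pos hz)).hasDerivAt.comp z
      (hasDerivAt_neg_one_div hz0)
    have h2 := (((hasDerivAt_id z).pow 2).mul (differentiableAt_meanLogDeriv hz).hasDerivAt).add
      ((hasDerivAt_id z).div_const 2)
    have heq : (meanLogDeriv ∘ fun w : ℂ ↦ -1 / w) =ᶠ[𝓝 z]
        fun w ↦ w ^ 2 * meanLogDeriv w + w / 2 := by
      filter_upwards [isOpen_upperHalfPlaneSet.mem_nhds hz] with w hw
      exact meanLogDeriv_neg_one_div hw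
    have h3 := (h1.congr_of_eventuallyEq heq.symm).unique h2
    simp only [Pi.pow_apply, id, Nat.cast_ofNat, Nat.add_one_sub_one] at h3
    have hzz : z ^ 2 * (1 / z ^ 2) = 1 := by field_simp
    linear_combination z ^ 2 * h3 - deriv meanLogDeriv (-1 / z) * hzz
  -- Subtracting `2 m²` cancels the non-modular terms of `m'`, and the value at `i∞` is `-2 (π i /
  -- 12)² = π² / 72`.
  have h := eq_E₄_of_generators (v := π ^ 2 / 72)
    (F := fun z ↦ deriv meanLogDeriv z - 2 * meanLogDeriv z ^ 2)
    (differentiableOn_of_forall fun z hz ↦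
      (hdd z hz).sub (((differentiableAt_meanLogDeriv hz).pow 2).const_mul 2))
    (fun z _ ↦ by simp only [hT, meanLogDeriv_add_one])
    (fun z hz ↦ by simp only [hS z hz, meanLogDeriv_neg_one_div hz]; ring)
    (by
      have h := (tendsto_deriv_comap_im (fun _ ↦ differentiableAt_meanLogDeriv)
        tendsto_meanLogDeriv).sub ((tendsto_meanLogDeriv.pow 2).const_mul 2)
      convert h using 2
      linear_combination (π ^ 2 / 72 : ℂ) * I_sq) τ
  linear_combination h

end Halphen

/-! ### Passing from functions on `ℍ` to formulas on `ℂ` -/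

section Transfer

lemma comp_ofComplex_eqOn {f : ℍ → ℂ} {F : ℂ → ℂ} (h : ∀ τ : ℍ, f τ = F τ) :
    Set.EqOn (f ∘ ofComplex) F {z | 0 < z.im} := fun z hz ↦ by
  rw [Function.comp_apply, ofComplex_apply_of_im_pos hz, h]

lemma D_eq_deriv {f : ℍ → ℂ} {F : ℂ → ℂ} (h : ∀ τ : ℍ, f τ = F τ) (τ : ℍ) :
    D f τ = deriv F τ :=
  ((comp_ofComplex_eqOn h).eventuallyEq_of_mem
    (isOpen_upperHalfPlaneSet.mem_nhds τ.im_pos)).deriv_eq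

lemma D_D_eq_deriv_deriv {f : ℍ → ℂ} {F : ℂ → ℂ} (h : ∀ τ : ℍ, f τ = F τ) (τ : ℍ) :
    D (D f) τ = deriv (deriv F) τ :=
  D_eq_deriv (D_eq_deriv h) τ

lemma holo_of_differentiableAt {f : ℍ → ℂ} {F : ℂ → ℂ} (h : ∀ τ : ℍ, f τ = F τ)
    (hF : ∀ z : ℂ, 0 < z.im → DifferentiableAt ℂ F z) : Holo f :=
  (differentiableOn_of_forall hF).congr (comp_ofComplex_eqOn h)

end Transfer

/-! ### The differential equation for `y₁` and `y₂`, and the derivative of `λ` -/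

section Solutions

/-- The extension of `y1` to `ℂ`. -/
def yOne (z : ℂ) : ℂ := thetaTwo z ^ 2 / (thetaThree z ^ 2 * thetaFour z ^ 2)

/-- The extension of `y2` to `ℂ`. -/
def yTwo (z : ℂ) : ℂ := thetaThree z ^ 2 / (thetaTwo z ^ 2 * thetaFour z ^ 2)

/-- The extension of `lam` to `ℂ`. -/
def lambda (z : ℂ) : ℂ := thetaTwo z ^ 4 / thetaThree z ^ 4

lemma y1_eq (τ : ℍ) : y1 τ = yOne τ := by
  rw [y1, yOne, theta2_eq, theta3_eq, theta4_eq]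

lemma y2_eq (τ : ℍ) : y2 τ = yTwo τ := by
  rw [y2, yTwo, theta2_eq, theta3_eq, theta4_eq]

lemma lam_eq (τ : ℍ) : lam τ = lambda τ := by
  rw [lam, lambda, theta2_eq, theta3_eq]

lemma hasDerivAt_of_logDeriv {F : ℂ → ℂ} {z : ℂ} (h : DifferentiableAt ℂ F z) (h0 : F z ≠ 0) :
    HasDerivAt F (logDeriv F z * F z) z := by
  rw [logDeriv_apply, div_mul_cancel₀ _ h0]
  exact h.hasDerivAt

lemma hasDerivAt_thetaTwo {z : ℂ} (hz : 0 < z.im) :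
    HasDerivAt thetaTwo (logDeriv thetaTwo z * thetaTwo z) z :=
  hasDerivAt_of_logDeriv (differentiableAt_thetaTwo hz) (thetaTwo_ne_zero hz)

lemma hasDerivAt_thetaThree {z : ℂ} (hz : 0 < z.im) :
    HasDerivAt thetaThree (logDeriv thetaThree z * thetaThree z) z :=
  hasDerivAt_of_logDeriv (differentiableAt_thetaThree hz) (thetaThree_ne_zero hz)

lemma hasDerivAt_thetaFour {z : ℂ} (hz : 0 < z.im) :
    HasDerivAt thetaFour (logDeriv thetaFour z * thetaFour z) z :=
  hasDerivAt_of_logDeriv (differentiableAt_thetaFour hz) (thetaFour_ne_zero hz)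

lemma hasDerivAt_yOne {z : ℂ} (hz : 0 < z.im) :
    HasDerivAt yOne ((-2 * meanLogDeriv z +
      π * Complex.I / 3 * (thetaThree z ^ 4 + thetaFour z ^ 4)) * yOne z) z := by
  have h2 := thetaTwo_ne_zero hz
  have h3 := thetaThree_ne_zero hz
  have h4 := thetaFour_ne_zero hz
  obtain ⟨e2, e3, e4⟩ := logDeriv_meanLogDeriv_identities hz
  refine (((hasDerivAt_thetaTwo hz).pow 2).div (((hasDerivAt_thetaThree hz).pow 2).mul
    ((hasDerivAt_thetaFour hz).pow 2)) (by simp [h3, h4])).congr_deriv ?_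
  simp only [yOne, Pi.mul_apply, Pi.pow_apply]
  rw [e2, e3, e4]
  field_simp
  push_cast
  ring

lemma hasDerivAt_yTwo {z : ℂ} (hz : 0 < z.im) :
    HasDerivAt yTwo ((-2 * meanLogDeriv z +
      π * Complex.I / 3 * (thetaTwo z ^ 4 - thetaFour z ^ 4)) * yTwo z) z := by
  have h2 := thetaTwo_ne_zero hz
  have h3 := thetaThree_ne_zero hz
  have h4 := thetaFour_ne_zero hz
  obtain ⟨e2, e3, e4⟩ := logDeriv_meanLogDeriv_identities hz
  refine (((hasDerivAt_thetaThree hz).pow 2).div (((hasDerivAt_thetaTwo hz).pow 2).mul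
    ((hasDerivAt_thetaFour hz).pow 2)) (by simp [h2, h4])).congr_deriv ?_
  simp only [yTwo, Pi.mul_apply, Pi.pow_apply]
  rw [e2, e3, e4]
  field_simp
  push_cast
  ring

/-- In `4 (θ₂'/θ₂ - θ₃'/θ₃)` the mean cancels, and Jacobi's identity reduces the rest to `π i θ₄⁴`.
-/
lemma hasDerivAt_lambda {z : ℂ} (hz : 0 < z.im) :
    HasDerivAt lambda (Complex.I * π * (thetaFour z ^ 2 * thetaTwo z ^ 2 / thetaThree z ^ 2) ^ 2) z := by
  have h3 := thetaThree_ne_zero hz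
  obtain ⟨e2, e3, -⟩ := logDeriv_meanLogDeriv_identities hz
  refine (((hasDerivAt_thetaTwo hz).pow 4).div ((hasDerivAt_thetaThree hz).pow 4)
    (by simp [h3])).congr_deriv ?_
  simp only [Pi.pow_apply]
  rw [e2, e3]
  field_simp
  push_cast
  linear_combination (4 * Complex.I * π * thetaTwo z ^ 4 * thetaThree z ^ 3) * jacobi_identity hz

/-- A solution of `Y' = U Y` has second derivative `(U' + U²) Y`. -/
lemma deriv_deriv_of_hasDerivAt_mul {Y U : ℂ → ℂ} {u : ℂ}
    (hY : ∀ z : ℂ, 0 < z.im → HasDerivAt Y (U z * Y z) z) {z : ℂ} (hz : 0 < z.im)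
    (hU : HasDerivAt U u z) : deriv (deriv Y) z = (u + U z ^ 2) * Y z := by
  have heq : deriv Y =ᶠ[𝓝 z] fun w ↦ U w * Y w := by
    filter_upwards [isOpen_upperHalfPlaneSet.mem_nhds hz] with w hw using (hY w hw).deriv
  rw [heq.deriv_eq, (hU.fun_mul (hY z hz)).deriv]
  ring

lemma hasDerivAt_meanLogDeriv (τ : ℍ) :
    HasDerivAt meanLogDeriv (2 * meanLogDeriv τ ^ 2 + π ^ 2 / 72 * E₄ τ) τ := by
  rw [← deriv_meanLogDeriv]
  exact (differentiableAt_meanLogDeriv τ.im_pos).hasDerivAt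

/-- Ramanujan's equation cancels the `m²` terms and contributes `-(π² / 36) E₄`; the terms linear in
`m` cancel through the Halphen system. The remaining quadratic form in fourth powers equals `-(2 π²
/ 9) E₄` by Jacobi's identity and `two_mul_E₄`. -/
lemma deriv_deriv_yOne (τ : ℍ) :
    deriv (deriv yOne) τ = -(π ^ 2 / 4 * E₄ τ) * yOne τ := by
  have hz := τ.im_pos
  obtain ⟨-, e3, e4⟩ := logDeriv_meanLogDeriv_identities hz
  have hU := ((hasDerivAt_meanLogDeriv τ).const_mul (-2)).fun_add
    ((((hasDerivAt_thetaThree hz).fun_pow 4).fun_add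
      ((hasDerivAt_thetaFour hz).fun_pow 4)).const_mul (π * Complex.I / 3))
  rw [deriv_deriv_of_hasDerivAt_mul (fun _ ↦ hasDerivAt_yOne) hz hU]
  congr 1
  rw [e3, e4]
  have hJ := jacobi_identity hz
  have hE := two_mul_E₄ τ
  push_cast
  linear_combination -(π ^ 2 / 9) * hE - π ^ 2 / 9 * thetaTwo τ ^ 4 * hJ +
    π ^ 2 / 9 * (thetaTwo τ ^ 4 * thetaThree τ ^ 4 - thetaTwo τ ^ 4 * thetaFour τ ^ 4 +
      (thetaThree τ ^ 4) ^ 2 + (thetaFour τ ^ 4) ^ 2) * I_sq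

lemma deriv_deriv_yTwo (τ : ℍ) :
    deriv (deriv yTwo) τ = -(π ^ 2 / 4 * E₄ τ) * yTwo τ := by
  have hz := τ.im_pos
  obtain ⟨e2, -, e4⟩ := logDeriv_meanLogDeriv_identities hz
  have hU := ((hasDerivAt_meanLogDeriv τ).const_mul (-2)).fun_add
    ((((hasDerivAt_thetaTwo hz).fun_pow 4).fun_sub
      ((hasDerivAt_thetaFour hz).fun_pow 4)).const_mul (π * Complex.I / 3))
  rw [deriv_deriv_of_hasDerivAt_mul (fun _ ↦ hasDerivAt_yTwo) hz hU]
  congr 1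
  rw [e2, e4]
  have hJ := jacobi_identity hz
  have hE := two_mul_E₄ τ
  push_cast
  linear_combination -(π ^ 2 / 9) * hE + π ^ 2 / 9 * thetaThree τ ^ 4 * hJ +
    π ^ 2 / 9 * ((thetaTwo τ ^ 4) ^ 2 + (thetaFour τ ^ 4) ^ 2 +
      thetaTwo τ ^ 4 * thetaThree τ ^ 4 + thetaThree τ ^ 4 * thetaFour τ ^ 4) * I_sq

lemma isSolution_y1 : IsSolution y1 :=
  ⟨holo_of_differentiableAt y1_eq fun _ hz ↦ (hasDerivAt_yOne hz).differentiableAt, fun τ ↦ by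
    rw [D_D_eq_deriv_deriv y1_eq, deriv_deriv_yOne, y1_eq]
    ring⟩

lemma isSolution_y2 : IsSolution y2 :=
  ⟨holo_of_differentiableAt y2_eq fun _ hz ↦ (hasDerivAt_yTwo hz).differentiableAt, fun τ ↦ by
    rw [D_D_eq_deriv_deriv y2_eq, deriv_deriv_yTwo, y2_eq]
    ring⟩

end Solutions

/-! ### Wronskians and the solution space -/

section Basis

lemma Holo.differentiableAt {f : ℍ → ℂ} (h : Holo f) (τ : ℍ) :
    DifferentiableAt ℂ (f ∘ ofComplex) τ :=
  DifferentiableOn.differentiableAt h (isOpen_upperHalfPlaneSet.mem_nhds τ.im_pos)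

lemma Holo.hasDerivAt {f : ℍ → ℂ} (h : Holo f) (τ : ℍ) :
    HasDerivAt (f ∘ ofComplex) (D f τ) τ :=
  (h.differentiableAt τ).hasDerivAt

lemma Holo.D {f : ℍ → ℂ} (h : Holo f) : Holo (D f) :=
  (DifferentiableOn.deriv h isOpen_upperHalfPlaneSet).congr (comp_ofComplex_eqOn fun _ ↦ rfl)

/-- The Wronskian of two functions on the upper half-plane. -/
def wronskian (f g : ℍ → ℂ) (τ : ℍ) : ℂ := f τ * D g τ - D f τ * g τ

/-- The derivative is `f g'' - f'' g`, which the equation kills; the half-plane is convex. -/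
lemma wronskian_eq_const {f g : ℍ → ℂ} (hf : IsSolution f) (hg : IsSolution g) :
    ∃ c : ℂ, ∀ τ, wronskian f g τ = c := by
  have hderiv (z : ℂ) (hz : 0 < z.im) : HasDerivAt (wronskian f g ∘ ofComplex) 0 z := by
    lift z to ℍ using hz
    have h := ((hf.1.hasDerivAt z).mul (hg.1.D.hasDerivAt z)).sub
      ((hf.1.D.hasDerivAt z).mul (hg.1.hasDerivAt z))
    refine h.congr_deriv ?_
    simp only [Function.comp_apply, ofComplex_apply]
    linear_combination f z * hg.2 z - g z * hf.2 z
  refine ⟨wronskian f g UpperHalfPlane.I, fun τ ↦ ?_⟩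
  have h := (convex_halfSpace_im_gt 0).is_const_of_fderivWithin_eq_zero
    (𝕜 := ℂ) (f := wronskian f g ∘ ofComplex)
    (differentiableOn_of_forall fun z hz ↦ (hderiv z hz).differentiableAt)
    (fun z hz ↦ by
      rw [fderivWithin_of_isOpen isOpen_upperHalfPlaneSet hz]
      simpa using (hderiv z hz).hasFDerivAt.fderiv) τ.im_pos UpperHalfPlane.I.im_pos
  simpa only [Function.comp_apply, ofComplex_apply] using h

/-- The Wronskian is `y₁ y₂` times the difference of the logarithmic derivatives. That difference is
`-π i θ₄⁴` by Jacobi's identity, while `y₁ y₂ = θ₄⁻⁴`. -/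
lemma wronskian_y1_y2 (τ : ℍ) : wronskian y1 y2 τ = -(π * Complex.I) := by
  have hz := τ.im_pos
  have h2 := thetaTwo_ne_zero hz
  have h3 := thetaThree_ne_zero hz
  have h4 := thetaFour_ne_zero hz
  rw [wronskian, D_eq_deriv y1_eq, D_eq_deriv y2_eq, (hasDerivAt_yOne hz).deriv,
    (hasDerivAt_yTwo hz).deriv, y1_eq, y2_eq]
  have h : yOne τ * yTwo τ * thetaFour τ ^ 4 = 1 := by
    rw [yOne, yTwo]
    field_simp
  linear_combination (-π * Complex.I / 3 * yOne τ * yTwo τ) * jacobi_identity hz - π * Complex.I * h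

lemma linearIndependent_y1_y2 : LinearIndependent ℂ ![y1, y2] := by
  rw [LinearIndependent.pair_iff]
  intro a b h
  have hW := wronskian_y1_y2 UpperHalfPlane.I
  have hW0 : -(π * Complex.I) ≠ 0 := by simp [Real.pi_ne_zero]
  set τ := UpperHalfPlane.I
  have h0 : a * y1 τ + b * y2 τ = 0 := congrFun h τ
  have h1 : a * D y1 τ + b * D y2 τ = 0 := by
    have hd := ((isSolution_y1.1.hasDerivAt τ).const_mul a).fun_add
      ((isSolution_y2.1.hasDerivAt τ).const_mul b)
    refine hd.unique ((hasDerivAt_const (τ : ℂ) (0 : ℂ)).congr_of_eventuallyEq ?_)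
    exact Eventually.of_forall fun z ↦ congrFun h (ofComplex z)
  rw [wronskian] at hW
  constructor
  · refine (mul_eq_zero.mp (?_ : a * -(π * Complex.I) = 0)).resolve_right hW0
    linear_combination (-a) * hW + D y2 τ * h0 - y2 τ * h1
  · refine (mul_eq_zero.mp (?_ : b * -(π * Complex.I) = 0)).resolve_right hW0
    linear_combination (-b) * hW + y1 τ * h1 - D y1 τ * h0

/-- Cramer's rule: `W(y, y₂) y₁ + W(y₁, y) y₂ = W(y₁, y₂) y` holds identically, and all three
Wronskians are constant. -/
lemma IsSolution.exists_eq_add {y : ℍ → ℂ} (hy : IsSolution y) :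
    ∃ a b : ℂ, y = a • y1 + b • y2 := by
  obtain ⟨c₁, h₁⟩ := wronskian_eq_const hy isSolution_y2
  obtain ⟨c₂, h₂⟩ := wronskian_eq_const isSolution_y1 hy
  have hW0 : -(π * Complex.I) ≠ 0 := by simp [Real.pi_ne_zero]
  refine ⟨c₁ / -(π * Complex.I), c₂ / -(π * Complex.I), funext fun τ ↦ ?_⟩
  have h₁ := h₁ τ
  have h₂ := h₂ τ
  have hW := wronskian_y1_y2 τ
  rw [wronskian] at h₁ h₂ hW
  simp only [Pi.add_apply, Pi.smul_apply, smul_eq_mul]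
  rw [div_mul_eq_mul_div, div_mul_eq_mul_div, ← add_div, eq_div_iff hW0]
  linear_combination y1 τ * h₁ + y2 τ * h₂ - y τ * hW

end Basis

/-! ### The branch of `√λ'` -/

section SquareRoot

lemma I_mul_pi_ne_zero : Complex.I * (π : ℂ) ≠ 0 := by simp [Real.pi_ne_zero]

lemma I_mul_pi_cpow_half_sq : ((Complex.I * π) ^ (1 / 2 : ℂ)) ^ 2 = Complex.I * π := by
  rw [one_div]
  exact_mod_cast cpow_nat_inv_pow (Complex.I * π) two_ne_zero

lemma I_mul_pi_cpow_half_ne_zero : (Complex.I * π : ℂ) ^ (1 / 2 : ℂ) ≠ 0 := by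
  simp [cpow_eq_zero_iff, Real.pi_ne_zero]

lemma D_lam (τ : ℍ) :
    D lam τ = Complex.I * π * (theta4 τ ^ 2 * theta2 τ ^ 2 / theta3 τ ^ 2) ^ 2 := by
  rw [D_eq_deriv lam_eq, (hasDerivAt_lambda τ.im_pos).deriv, theta2_eq, theta3_eq, theta4_eq]

lemma sqrtLamDeriv_sq (τ : ℍ) : sqrtLamDeriv τ ^ 2 = D lam τ := by
  rw [sqrtLamDeriv, mul_pow, I_mul_pi_cpow_half_sq, D_lam]

lemma theta_ne_zero (τ : ℍ) : theta2 τ ≠ 0 ∧ theta3 τ ≠ 0 ∧ theta4 τ ≠ 0 := by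
  rw [theta2_eq, theta3_eq, theta4_eq]
  exact ⟨thetaTwo_ne_zero τ.im_pos, thetaThree_ne_zero τ.im_pos, thetaFour_ne_zero τ.im_pos⟩

lemma D_lam_ne_zero (τ : ℍ) : D lam τ ≠ 0 := by
  obtain ⟨h2, h3, h4⟩ := theta_ne_zero τ
  rw [D_lam]
  exact mul_ne_zero I_mul_pi_ne_zero (by simp [h2, h3, h4])

lemma holo_sqrtLamDeriv : Holo sqrtLamDeriv :=
  holo_of_differentiableAt (F := fun z ↦
    (Complex.I * π) ^ (1 / 2 : ℂ) * (thetaFour z ^ 2 * thetaTwo z ^ 2 / thetaThree z ^ 2))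
    (fun τ ↦ by rw [sqrtLamDeriv, theta2_eq, theta3_eq, theta4_eq])
    fun _ hz ↦ ((((differentiableAt_thetaFour hz).pow 2).mul
      ((differentiableAt_thetaTwo hz).pow 2)).div ((differentiableAt_thetaThree hz).pow 2)
      (pow_ne_zero 2 (thetaThree_ne_zero hz))).const_mul _

lemma lam_div_sqrtLamDeriv (τ : ℍ) :
    lam τ / sqrtLamDeriv τ = (Complex.I * π) ^ (-(1 / 2) : ℂ) * y1 τ := by
  obtain ⟨h2, h3, h4⟩ := theta_ne_zero τ
  have h := I_mul_pi_cpow_half_ne_zero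
  rw [cpow_neg, lam, sqrtLamDeriv, y1]
  -- Only `r ≠ 0` matters from here on, not the choice of branch.
  generalize (Complex.I * π : ℂ) ^ (1 / 2 : ℂ) = r at h
  field_simp

lemma one_div_sqrtLamDeriv (τ : ℍ) :
    1 / sqrtLamDeriv τ = (Complex.I * π) ^ (-(1 / 2) : ℂ) * y2 τ := by
  obtain ⟨h2, h3, h4⟩ := theta_ne_zero τ
  have h := I_mul_pi_cpow_half_ne_zero
  rw [cpow_neg, sqrtLamDeriv, y2]
  generalize (Complex.I * π : ℂ) ^ (1 / 2 : ℂ) = r at h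
  field_simp

end SquareRoot

end ThetaODE

end

end

theorem mainTheorem12 :
    -- the quotients below are well defined
    (∀ τ : UpperHalfPlane,
      ThetaODE.theta2 τ ≠ 0 ∧ ThetaODE.theta3 τ ≠ 0 ∧ ThetaODE.theta4 τ ≠ 0) ∧
    -- `y₁`, `y₂` form a basis of the space of solutions
    ThetaODE.IsSolution ThetaODE.y1 ∧
    ThetaODE.IsSolution ThetaODE.y2 ∧
    LinearIndependent ℂ ![ThetaODE.y1, ThetaODE.y2] ∧
    (∀ y : UpperHalfPlane → ℂ, ThetaODE.IsSolution y →
      ∃ a b : ℂ, y = a • ThetaODE.y1 + b • ThetaODE.y2) ∧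
    -- they are `λ / √λ'` and `1 / √λ'` up to a constant, for a holomorphic branch of `√λ'`
    ThetaODE.Holo ThetaODE.lam ∧
    ThetaODE.Holo ThetaODE.sqrtLamDeriv ∧
    (∀ τ : UpperHalfPlane,
      ThetaODE.D ThetaODE.lam τ ≠ 0 ∧
      ThetaODE.sqrtLamDeriv τ ^ 2 = ThetaODE.D ThetaODE.lam τ ∧
      ThetaODE.lam τ / ThetaODE.sqrtLamDeriv τ =
        (Complex.I * Real.pi) ^ (-(1 / 2) : ℂ) * ThetaODE.y1 τ ∧
      1 / ThetaODE.sqrtLamDeriv τ =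
        (Complex.I * Real.pi) ^ (-(1 / 2) : ℂ) * ThetaODE.y2 τ) := by
  open ThetaODE in
  exact ⟨theta_ne_zero, isSolution_y1, isSolution_y2, linearIndependent_y1_y2,
    fun _ ↦ IsSolution.exists_eq_add,
    holo_of_differentiableAt lam_eq fun _ hz ↦ (hasDerivAt_lambda hz).differentiableAt,
    holo_sqrtLamDeriv, fun τ ↦ ⟨D_lam_ne_zero τ, sqrtLamDeriv_sq τ, lam_div_sqrtLamDeriv τ,
      one_div_sqrtLamDeriv τ⟩⟩
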